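/- Fix integers $K, T$, constants $b_0,\dots,b_{T-1}>0$, vectors $h, s\in\mathbb R^K$ and $C<\infty$. A policy is a family of measurable maps $\pi_t:(\mathbb R^K)^t\to\Delta_K$, $0\le t\le T-1$, into the probability simplex $\Delta_K=\{p\in[0,1]^K:\sum_a p_a=1\}$; the probabilities $\pi_{t,a}$ may be zero. *Batched experiment.* For each scaling parameter $n$, consider an experiment in which epoch $t$ has a batch of $b_tn$ units (rounded down if this is not an integer). Unit $j$ of epoch $t$ has potential rewards $R^t_{a,j}=h_a/\sqrt n+\epsilon^t_{a,j}$ for the arms $a=1,\dots,K$, and $\xi^t_{a,j}\in\{0,1\}$ indicates that it is assigned arm $a$; exactly one arm is assigned to each unit. Write $$\bar R^n_{t,a}=\frac1{b_tn}\sum_{j}\xi^t_{a,j}R^t_{a,j},\qquad \bar R^n_t=(\bar R^n_{t,a})_{a=1}^K .$$ Assume that for every $n$ and $t$: 1. (Rewards.) The noise vectors $\epsilon^t_j=(\epsilon^t_{a,j})_{a=1}^K$ all have the same law, which may depend on $n$ but not on $t, j$; each $\epsilon^t_j$ is independent of $(\bar R^n_0,\dots,\bar R^n_{t-1})$; and $\mathbb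 E\,\epsilon^t_{a,j}=0$, $\operatorname{Var}(\epsilon^t_{a,j})=s_a^2$, $\mathbb E\|\epsilon^t_j\|_2^4\le C$. 2. (Sampling, sufficiency.) Conditionally on $\bar R^n_0,\dots,\bar R^n_{t-1}$, the pairs $(\xi^t_j,R^t_j)$ are independent across the units $j$ of epoch $t$, and $\xi^t_{a,j}=1$ with probability $\pi_{t,a}(\sqrt n\bar R^n_0,\dots,\sqrt n\bar R^n_{t-1})$. 3. (Ignorability.) For each unit $j$, $\xi^t_j$ and $R^t_j$ are independent conditionally on $\bar R^n_0,\dots,\bar R^n_{t-1}$. *Gaussian sequential experiment.* Let $G_0,\dots,G_{T-1}$ be random vectors in $\mathbb R^K$ such that, for every $t$, $$G_t\mid G_0,\dots,G_{t-1}\ \sim\ N\!\left(\{\pi_{t,a}h_a\}_{a=1}^K,\ \operatorname{diag}\big(\{\pi_{t,a}s_a^2/b_t\}_{a=1}^K\big)\right),\qquad \pi_t=\pi_t(G_0,\dots,G_{t-1}).$$ Assume that for every $t$ the set of discontinuity points of $\pi_t$ has measure zero under the law of $(G_0,\dots,G_{t-1})$. Then, as $n\to\infty$, $$(\sqrt n\,\bar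 R^n_0,\dots,\sqrt n\,\bar R^n_{T-1})\ \xrightarrow{d}\ (G_0,\dots,G_{T-1})\quad\text{jointly, in }(\mathbb R^K)^T .$$ -/

import Mathlib

open MeasureTheory ProbabilityTheory Filter Topology
open scoped ENNReal NNReal

noncomputable section

namespace GaussianSequentialExperiment

/-- The coordinates strictly before `t` of a `T`-tuple `x = (x_0, …, x_{T-1})`. -/
def past {T : ℕ} {E : Type*} (x : Fin T → E) (t : Fin T) : Fin t → E :=
  fun s => x (Fin.castLE t.isLt.le s)

/-- A sampling policy for `K` arms and `T` epochs: the allocation of epoch `t` is a point of the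
probability simplex, a function of the `t` vectors of observations made before epoch `t`. -/
abbrev Policy (K T : ℕ) : Type :=
  (t : Fin T) → (Fin t → Fin K → ℝ) → stdSimplex ℝ (Fin K)

/-- Conditional independence of the random variables `f` and `g` given the random variable `H`, on
an arbitrary probability space. -/
def CondIndepGiven {Ω α β γ : Type*} [MeasurableSpace Ω] [MeasurableSpace α] [MeasurableSpace β]
    [MeasurableSpace γ] (H : Ω → α) (f : Ω → β) (g : Ω → γ) (P : Measure Ω) : Prop :=
  ∀ (u : Set β) (v : Set γ), MeasurableSet u → MeasurableSet v →
    P⟦f ⁻¹' u ∩ g ⁻¹' v | MeasurableSpace.comap H inferInstance⟧ =ᵐ[P]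
      fun ω => (P⟦f ⁻¹' u | MeasurableSpace.comap H inferInstance⟧) ω
        * (P⟦g ⁻¹' v | MeasurableSpace.comap H inferInstance⟧) ω

/-- Mutual conditional independence of a finite family of random variables given the random
variable `H`, on an arbitrary probability space. Subfamilies are covered by `u i = univ`. -/
def ICondIndepGiven {ι Ω α β : Type*} [Fintype ι] [MeasurableSpace Ω] [MeasurableSpace α]
    [MeasurableSpace β] (H : Ω → α) (f : ι → Ω → β) (P : Measure Ω) : Prop :=
  ∀ u : ι → Set β, (∀ i, MeasurableSet (u i)) →
    P⟦⋂ i, f i ⁻¹' u i | MeasurableSpace.comap H inferInstance⟧ =ᵐ[P]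
      fun ω => ∏ i, (P⟦f i ⁻¹' u i | MeasurableSpace.comap H inferInstance⟧) ω

/-- The number of units of epoch `t`, namely `b_t n` (rounded down if it is not an integer). -/
def batchSize {T : ℕ} (b : Fin T → ℝ) (n : ℕ) (t : Fin T) : ℕ :=
  ⌊b t * n⌋₊

/-- The vector of potential rewards `R_a = h_a / √n + ε_a` of a unit with noise vector `e`. -/
def reward {K : ℕ} (h : Fin K → ℝ) (n : ℕ) (e : Fin K → ℝ) : Fin K → ℝ :=
  fun a => h a / √(n : ℝ) + e a

/-- The indicator `ξ_a` that the arm `x` drawn for a unit is the arm `a`. -/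
def pulled {K : ℕ} (x a : Fin K) : ℝ :=
  if x = a then 1 else 0

/-- The batch sample means `R̄_{t,a} = (b_t n)⁻¹ ∑_j ξ_{a,j}^t R_{a,j}^t`, where unit `j` of epoch
`t` is assigned the arm `A t j` and has noise vector `ε t j`. -/
def batchMean {K T : ℕ} {Ω : Type*} (b : Fin T → ℝ) (h : Fin K → ℝ) (n : ℕ)
    (A : (t : Fin T) → Fin (batchSize b n t) → Ω → Fin K)
    (ε : (t : Fin T) → Fin (batchSize b n t) → Ω → Fin K → ℝ)
    (t : Fin T) (ω : Ω) : Fin K → ℝ :=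
  fun a => (b t * n)⁻¹ * ∑ j, pulled (A t j ω) a * reward h n (ε t j ω) a

/-- The sequence `(√n R̄_0, …, √n R̄_{T-1})` of scaled batch sample means. -/
def scaledMeans {K T : ℕ} {Ω : Type*} (b : Fin T → ℝ) (h : Fin K → ℝ) (n : ℕ)
    (A : (t : Fin T) → Fin (batchSize b n t) → Ω → Fin K)
    (ε : (t : Fin T) → Fin (batchSize b n t) → Ω → Fin K → ℝ)
    (ω : Ω) : Fin T → Fin K → ℝ :=
  fun t a => √(n : ℝ) * batchMean b h n A ε t ω a

/-- The aggregate rewards `(√n R̄_0, …, √n R̄_{t-1})` observed before epoch `t`. -/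
def pastMeans {K T : ℕ} {Ω : Type*} (b : Fin T → ℝ) (h : Fin K → ℝ) (n : ℕ)
    (A : (t : Fin T) → Fin (batchSize b n t) → Ω → Fin K)
    (ε : (t : Fin T) → Fin (batchSize b n t) → Ω → Fin K → ℝ)
    (t : Fin T) (ω : Ω) : Fin t → Fin K → ℝ :=
  past (scaledMeans b h n A ε ω) t

/-- `ν` is a law of the noise vector `ε ∈ ℝ^K` of a unit: it is centered, the coordinate `ε_a` has
variance `s_a²`, and `E ‖ε‖₂⁴ ≤ C`. -/
structure IsNoiseLaw {K : ℕ} (s : Fin K → ℝ) (C : ℝ≥0) (ν : Measure (Fin K → ℝ)) : Prop where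
  isProbabilityMeasure : IsProbabilityMeasure ν
  mean_zero : ∀ a, ∫ e, e a ∂ν = 0
  variance : ∀ a, Var[fun e => e a; ν] = s a ^ 2
  fourth_moment : ∫⁻ e, ‖WithLp.toLp 2 e‖ₑ ^ 4 ∂ν ≤ C

/-- The batched adaptive experiment with scaling parameter `n`, played with the policy `π`.
Rewards within a batch are i.i.d., with noise law `ν`, and are not influenced by the aggregate
rewards of the past; given those, the units of a batch are independent, each of them is assigned
an arm with law `π_t`, and its assignment is independent of its potential rewards. -/
structure IsBatchedExperiment {K T : ℕ} {Ω : Type*} [MeasurableSpace Ω]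
    (b : Fin T → ℝ) (h : Fin K → ℝ) (π : Policy K T) (n : ℕ) (ν : Measure (Fin K → ℝ))
    (A : (t : Fin T) → Fin (batchSize b n t) → Ω → Fin K)
    (ε : (t : Fin T) → Fin (batchSize b n t) → Ω → Fin K → ℝ)
    (P : Measure Ω) : Prop where
  measurable_arm : ∀ t j, Measurable (A t j)
  measurable_noise : ∀ t j, Measurable (ε t j)
  noise_law : ∀ t j, P.map (ε t j) = ν
  noise_indep_past : ∀ t j, IndepFun (ε t j) (pastMeans b h n A ε t) P
  units_condIndep : ∀ t,
    ICondIndepGiven (pastMeans b h n A ε t) (fun j ω => (A t j ω, ε t j ω)) P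
  arm_law : ∀ t j a,
    P⟦A t j ⁻¹' {a} | MeasurableSpace.comap (pastMeans b h n A ε t) inferInstance⟧
      =ᵐ[P] fun ω => (π t (pastMeans b h n A ε t ω) : Fin K → ℝ) a
  ignorability : ∀ t j,
    CondIndepGiven (pastMeans b h n A ε t) (A t j) (fun ω => reward h n (ε t j ω)) P

/-- The Gaussian law `N({p_a h_a}_a, diag({p_a s_a² / c}_a))` on `ℝ^K`. -/
def gaussianObs {K : ℕ} (h s : Fin K → ℝ) (c : ℝ) (p : Fin K → ℝ) : Measure (Fin K → ℝ) :=
  Measure.pi fun a => gaussianReal (p a * h a) (p a * s a ^ 2 / c).toNNReal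

/-- `G = (G_0, …, G_{T-1})` is a Gaussian sequential experiment: for each `t`, the conditional
distribution of `G_t` given `G_0, …, G_{t-1}` is `N(π_t h, diag(π_t s² / b_t))`, where `π_t` is
evaluated at `(G_0, …, G_{t-1})`. -/
structure IsGaussianSequentialExperiment {K T : ℕ} {Ω : Type*} [MeasurableSpace Ω]
    (b : Fin T → ℝ) (h s : Fin K → ℝ) (π : Policy K T)
    (G : Ω → Fin T → Fin K → ℝ) (Q : Measure Ω) [IsFiniteMeasure Q] : Prop where
  measurable : Measurable G
  cond_law : ∀ t : Fin T, ∀ᵐ r ∂(Q.map fun ω => past (G ω) t),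
    condDistrib (fun ω => G ω t) (fun ω => past (G ω) t) Q r
      = gaussianObs h s (b t) (π t r)

end GaussianSequentialExperiment

end

/-! Induct on the number of epochs, with joint characteristic functions. Suppose that the scaled
means of the epochs before `t` converge in law. Given the past, the units of epoch `t` are i.i.d.
pairs of an arm drawn from `p = π_t` and an independent noise vector. The conditional characteristic
function of the new mean is therefore the power `(∑ a, p_a ψ_{n,a}) ^ N`, where `N` is the batch
size and `ψ_{n,a}` comes from one unit assigned arm `a`.

Centering, the variance and the uniform fourth moment give `n (ψ_{n,a} - 1) → m_a`, so the power
tends to `exp (b_t ∑ a, p_a m_a)`, which is exactly the characteristic function of the Gaussian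
observation with allocation `p`. The exponent is linear in `p` and nothing is divided by `p_a`, so
arms of probability zero need no separate treatment.

The allocation is random and varies with `n`, so this convergence has to be uniform over the
simplex: `exists_tendsto_zero_norm_mixture_pow_sub_le`. What remains is the expectation of a bounded
function of the past and of `π_t`, continuous in the pair. It converges by the induction hypothesis
and the mapping theorem, because the discontinuities of `π_t` are null for the limit law. Lévy's
theorem then returns convergence in law for one more epoch. -/

namespace GaussianSequentialExperiment

/-! ### Weak convergence: mapping theorem and Lévy continuity. -/

section WeakConvergence

variable {ι : Type*} {Ω : ι → Type*} [∀ i, MeasurableSpace (Ω i)] {Ω' : Type*} [MeasurableSpace Ω']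
  {μ : (i : ι) → Measure (Ω i)} [∀ i, IsProbabilityMeasure (μ i)]
  {μ' : Measure Ω'} [IsProbabilityMeasure μ'] {l : Filter ι}

/-- The **mapping theorem** for a map that is continuous almost everywhere for the limit law. -/
theorem tendstoInDistribution_comp_of_ae_continuousAt [l.IsCountablyGenerated]
    {E F : Type*} [TopologicalSpace E] [MeasurableSpace E] [OpensMeasurableSpace E]
    [HasOuterApproxClosed E]
    [TopologicalSpace F] [MeasurableSpace F] [OpensMeasurableSpace F]
    {X : (i : ι) → Ω i → E} {Z : Ω' → E} {g : E → F} (hg : Measurable g)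
    (hc : (μ'.map Z) {x | ¬ ContinuousAt g x} = 0) (h : TendstoInDistribution X l Z μ μ') :
    TendstoInDistribution (fun i ω => g (X i ω)) l (fun ω => g (Z ω)) μ μ' where
  forall_aemeasurable i := hg.comp_aemeasurable (h.forall_aemeasurable i)
  aemeasurable_limit := hg.comp_aemeasurable h.aemeasurable_limit
  tendsto := by
    refine tendsto_of_forall_isClosed_limsup_le' fun S hS => ?_
    -- A limit point of `g ⁻¹' S` at which `g` is continuous is mapped into `closure S = S`. Closing
    -- the preimage thus adds only discontinuity points, a null set, and the portmanteau bound for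
    -- closed sets applies.
    have hclosure : closure (g ⁻¹' S) ⊆ g ⁻¹' S ∪ {x | ¬ ContinuousAt g x} := by
      intro x hx
      by_cases hgx : ContinuousAt g x
      · refine Or.inl ?_
        have : g x ∈ closure S := by
          rw [mem_closure_iff_frequently] at hx ⊢
          exact Tendsto.frequently hgx hx
        rwa [hS.closure_eq] at this
      · exact Or.inr hgx
    have hle : limsup (fun i => ((μ i).map (X i)) (closure (g ⁻¹' S))) l
        ≤ (μ'.map Z) (closure (g ⁻¹' S)) :=
      ProbabilityMeasure.limsup_measure_closed_le_of_tendsto h.tendsto isClosed_closure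
    calc limsup (fun i => ((μ i).map (fun ω => g (X i ω))) S) l
        ≤ limsup (fun i => ((μ i).map (X i)) (closure (g ⁻¹' S))) l := by
          refine limsup_le_limsup (Eventually.of_forall fun i => ?_)
          have := AEMeasurable.map_map_of_aemeasurable hg.aemeasurable (h.forall_aemeasurable i)
          change ((μ i).map (g ∘ X i)) S ≤ _
          rw [← this, Measure.map_apply hg hS.measurableSet]
          exact measure_mono subset_closure
      _ ≤ (μ'.map Z) (closure (g ⁻¹' S)) := hle
      _ ≤ (μ'.map Z) (g ⁻¹' S ∪ {x | ¬ ContinuousAt g x}) := measure_mono hclosure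
      _ ≤ (μ'.map Z) (g ⁻¹' S) := by
          refine (measure_union_le _ _).trans ?_
          rw [hc, add_zero]
      _ = (μ'.map (fun ω => g (Z ω))) S := by
          have := AEMeasurable.map_map_of_aemeasurable hg.aemeasurable h.aemeasurable_limit
          change _ = (μ'.map (g ∘ Z)) S
          rw [← this, Measure.map_apply hg hS.measurableSet]

theorem TendstoInDistribution.tendsto_integral {E : Type*} [TopologicalSpace E]
    [MeasurableSpace E] [BorelSpace E] {X : (i : ι) → Ω i → E} {Z : Ω' → E}
    (h : TendstoInDistribution X l Z μ μ') {f : E → ℂ} (hf : Continuous f) {M : ℝ}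
    (hM : ∀ x, ‖f x‖ ≤ M) :
    Tendsto (fun i => ∫ ω, f (X i ω) ∂μ i) l (𝓝 (∫ ω, f (Z ω) ∂μ')) := by
  have := (ProbabilityMeasure.tendsto_iff_forall_integral_rclike_tendsto ℂ).1 h.tendsto
    (BoundedContinuousFunction.ofNormedAddCommGroup f hf M hM)
  simp only [ProbabilityMeasure.coe_mk, BoundedContinuousFunction.coe_ofNormedAddCommGroup] at this
  rw [integral_map h.aemeasurable_limit hf.measurable.aestronglyMeasurable] at this
  refine this.congr fun i => ?_
  rw [integral_map (h.forall_aemeasurable i) hf.measurable.aestronglyMeasurable]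

end WeakConvergence

/-- **Lévy's continuity theorem** for random arrays. -/
theorem tendstoInDistribution_of_tendsto_integral_exp {I J : Type*} [Fintype I] [Fintype J]
    {Ω : ℕ → Type*} [∀ n, MeasurableSpace (Ω n)] {Ω' : Type*} [MeasurableSpace Ω']
    {μ : (n : ℕ) → Measure (Ω n)} [∀ n, IsProbabilityMeasure (μ n)]
    {μ' : Measure Ω'} [IsProbabilityMeasure μ']
    {X : (n : ℕ) → Ω n → I → J → ℝ} {Z : Ω' → I → J → ℝ}
    (hX : ∀ n, Measurable (X n)) (hZ : Measurable Z)
    (h : ∀ u : I → J → ℝ, Tendsto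
      (fun n => ∫ ω, Complex.exp ((∑ i, ∑ j, u i j * X n ω i j : ℝ) * Complex.I) ∂μ n) atTop
      (𝓝 (∫ ω, Complex.exp ((∑ i, ∑ j, u i j * Z ω i j : ℝ) * Complex.I) ∂μ'))) :
    TendstoInDistribution X atTop Z μ μ' := by
  -- `charFun` requires an inner product, so arrays are flattened to a Euclidean space. The
  -- continuous left inverse `e'` brings the conclusion back.
  let e : (I → J → ℝ) → EuclideanSpace ℝ (I × J) := fun x => WithLp.toLp 2 fun q => x q.1 q.2
  let e' : EuclideanSpace ℝ (I × J) → I → J → ℝ := fun y i j => y (i, j)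
  have he : Continuous e := by
    refine (PiLp.continuous_toLp 2 _).comp ?_
    fun_prop
  have he' : Continuous e' := by fun_prop
  have key : TendstoInDistribution (fun n ω => e (X n ω)) atTop (fun ω => e (Z ω)) μ μ' := by
    refine ⟨fun n => (he.measurable.comp (hX n)).aemeasurable,
      (he.measurable.comp hZ).aemeasurable, ?_⟩
    refine ProbabilityMeasure.tendsto_of_tendsto_charFun fun t => ?_
    have hexp : ∀ x : I → J → ℝ, Complex.exp (((inner ℝ (e x) t : ℝ) : ℂ) * Complex.I)
        = Complex.exp ((∑ i, ∑ j, t (i, j) * x i j : ℝ) * Complex.I) := by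
      intro x
      congr 3
      rw [PiLp.inner_apply, Fintype.sum_prod_type]
      simp [e]
    have hmeas : Measurable fun x : EuclideanSpace ℝ (I × J) =>
        Complex.exp (((inner ℝ x t : ℝ) : ℂ) * Complex.I) := by fun_prop
    simp only [ProbabilityMeasure.coe_mk, charFun_apply]
    rw [integral_map (φ := fun ω => e (Z ω)) (he.measurable.comp hZ).aemeasurable
      hmeas.aestronglyMeasurable]
    simp only [hexp]
    refine (h fun i j => t (i, j)).congr fun n => ?_
    rw [integral_map (φ := fun ω => e (X n ω)) (he.measurable.comp (hX n)).aemeasurable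
      hmeas.aestronglyMeasurable]
    simp only [hexp]
  exact key.continuous_comp he'

end GaussianSequentialExperiment

namespace GaussianSequentialExperiment

/-! ### Conditionally i.i.d. families as kernels. -/

section ConditionalLaw

variable {Ω α β : Type*} [MeasurableSpace Ω] [MeasurableSpace α] [MeasurableSpace β]
  {P : Measure Ω} [IsProbabilityMeasure P] {H : Ω → α}

/-- The kernel of i.i.d. samples, indexed by `ι`, of a Markov kernel. -/
noncomputable def iidKernel (ι : Type*) [Fintype ι] (κ : Kernel α β) [IsMarkovKernel κ] :
    Kernel α (ι → β) where
  toFun r := Measure.pi fun _ => κ r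
  measurable' := by
    refine Measurable.measure_of_isPiSystem_of_isProbabilityMeasure generateFrom_pi.symm
      isPiSystem_pi ?_
    rintro _ ⟨u, hu, rfl⟩
    simp only [Measure.pi_pi]
    exact Finset.measurable_prod _ fun i _ => κ.measurable_coe (hu i (Set.mem_univ i))

instance (ι : Type*) [Fintype ι] (κ : Kernel α β) [IsMarkovKernel κ] :
    IsMarkovKernel (iidKernel ι κ) :=
  ⟨fun r => by change IsProbabilityMeasure (Measure.pi fun _ => κ r); infer_instance⟩

/-- Conditionally independent random variables with a common conditional law, given `H`, are
conditionally i.i.d. samples of that law. -/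
theorem map_prodMk_eq_compProd_iidKernel {ι : Type*} [Fintype ι] (hH : Measurable H)
    {f : ι → Ω → β} (hf : ∀ j, Measurable (f j)) (κ : Kernel α β) [IsMarkovKernel κ]
    (hindep : ICondIndepGiven H f P)
    (hlaw : ∀ j u, MeasurableSet u →
      P⟦f j ⁻¹' u | MeasurableSpace.comap H inferInstance⟧ =ᵐ[P] fun ω => (κ (H ω)).real u) :
    P.map (fun ω => (H ω, fun j => f j ω)) = (P.map H) ⊗ₘ iidKernel ι κ := by
  have hF : Measurable fun ω => (H ω, fun j => f j ω) := by fun_prop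
  have : IsProbabilityMeasure (P.map fun ω => (H ω, fun j => f j ω)) :=
    Measure.isProbabilityMeasure_map hF.aemeasurable
  have : IsProbabilityMeasure (P.map H) := Measure.isProbabilityMeasure_map hH.aemeasurable
  -- Both laws are compared on the π-system of boxes `B ×ˢ Set.univ.pi u`, where the defining
  -- property of conditional expectation on `H ⁻¹' B` gives equality.
  refine ext_of_generate_finite _ (generateFrom_eq_prod MeasurableSpace.generateFrom_measurableSet
    generateFrom_pi isCountablySpanning_measurableSet
    (IsCountablySpanning.pi fun _ => isCountablySpanning_measurableSet)).symm
    (MeasurableSpace.isPiSystem_measurableSet.prod isPiSystem_pi) ?_ (by simp)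
  rintro _ ⟨B, hB, _, ⟨u, hu, rfl⟩, rfl⟩
  replace hu : ∀ j, MeasurableSet (u j) := fun j => hu j (Set.mem_univ j)
  have hB : MeasurableSet B := hB
  have hU : MeasurableSet (⋂ j, f j ⁻¹' u j) := MeasurableSet.iInter fun j => hf j (hu j)
  have hpre : (fun ω => (H ω, fun j => f j ω)) ⁻¹' (B ×ˢ Set.univ.pi u)
      = (⋂ j, f j ⁻¹' u j) ∩ H ⁻¹' B := by
    ext ω; simp [and_comm]
  have hm : MeasurableSpace.comap H inferInstance ≤ (inferInstance : MeasurableSpace Ω) :=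
    hH.comap_le
  rw [Measure.map_apply hF (hB.prod (MeasurableSet.univ_pi hu)),
    Measure.compProd_apply_prod hB (MeasurableSet.univ_pi hu),
    setLIntegral_map hB (Kernel.measurable_coe _ (MeasurableSet.univ_pi hu)) hH, hpre]
  have hreal : P.real ((⋂ j, f j ⁻¹' u j) ∩ H ⁻¹' B)
      = ∫ ω in H ⁻¹' B, ∏ j, (κ (H ω)).real (u j) ∂P := by
    have hint : Integrable ((⋂ j, f j ⁻¹' u j).indicator fun _ => (1 : ℝ)) P :=
      (integrable_const 1).indicator hU
    have hset : P.real ((⋂ j, f j ⁻¹' u j) ∩ H ⁻¹' B)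
        = ∫ ω in H ⁻¹' B, (⋂ j, f j ⁻¹' u j).indicator (fun _ => (1 : ℝ)) ω ∂P := by
      rw [integral_indicator_const _ hU, measureReal_restrict_apply hU]
      simp
    rw [hset, ← setIntegral_condExp hm hint ⟨B, hB, rfl⟩]
    refine integral_congr_ae (ae_restrict_of_ae ?_)
    filter_upwards [hindep u hu, ae_all_iff.2 fun j => hlaw j (u j) (hu j)] with ω h1 h2
    rw [h1]
    exact Finset.prod_congr rfl fun j _ => h2 j
  have hmeas : Measurable fun ω => ∏ j, (κ (H ω)).real (u j) :=
    Finset.measurable_prod _ fun j _ => ((κ.measurable_coe (hu j)).comp hH).ennreal_toReal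
  have hnn : ∀ ω, 0 ≤ ∏ j, (κ (H ω)).real (u j) := fun ω =>
    Finset.prod_nonneg fun j _ => measureReal_nonneg
  have hpi : ∀ r, iidKernel ι κ r (Set.univ.pi u) = ENNReal.ofReal (∏ j, (κ r).real (u j)) := by
    intro r
    change (Measure.pi fun _ => κ r) _ = _
    rw [Measure.pi_pi, ENNReal.ofReal_prod_of_nonneg fun j _ => measureReal_nonneg]
    simp
  simp only [hpi]
  rw [← ofReal_integral_eq_lintegral_ofReal, ← hreal]
  · simp
  · refine Integrable.of_bound hmeas.aestronglyMeasurable 1 (Eventually.of_forall fun ω => ?_)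
    rw [Real.norm_of_nonneg (hnn ω)]
    exact Finset.prod_le_one (fun _ _ => measureReal_nonneg) fun _ _ => measureReal_le_one
  · exact Eventually.of_forall hnn

/-- By Fubini for the product measure, a product over conditionally i.i.d. units integrates to a
power of a one-unit integral. This reduces an epoch to a single unit; the weight `F` carries the
characteristic function of the past. -/
theorem integral_mul_prod_eq_integral_mul_pow {ι : Type*} [Fintype ι] (hH : Measurable H)
    {f : ι → Ω → β} (hf : ∀ j, Measurable (f j)) (κ : Kernel α β) [IsMarkovKernel κ]
    (hindep : ICondIndepGiven H f P)
    (hlaw : ∀ j u, MeasurableSet u →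
      P⟦f j ⁻¹' u | MeasurableSpace.comap H inferInstance⟧ =ᵐ[P] fun ω => (κ (H ω)).real u)
    {F : α → ℂ} (hF : Measurable F) (hF1 : ∀ r, ‖F r‖ ≤ 1)
    {g : β → ℂ} (hg : Measurable g) (hg1 : ∀ x, ‖g x‖ ≤ 1) :
    ∫ ω, F (H ω) * ∏ j, g (f j ω) ∂P
      = ∫ ω, F (H ω) * (∫ x, g x ∂κ (H ω)) ^ Fintype.card ι ∂P := by
  have : IsProbabilityMeasure (P.map H) := Measure.isProbabilityMeasure_map hH.aemeasurable
  have hm : Measurable fun z : α × (ι → β) => F z.1 * ∏ j, g (z.2 j) := by fun_prop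
  have hmap : ∫ ω, F (H ω) * ∏ j, g (f j ω) ∂P
      = ∫ z, F z.1 * ∏ j, g (z.2 j) ∂(P.map fun ω => (H ω, fun j => f j ω)) := by
    rw [integral_map (by fun_prop) hm.aestronglyMeasurable]
  rw [hmap, map_prodMk_eq_compProd_iidKernel hH hf κ hindep hlaw, Measure.integral_compProd]
  · have hpi : ∀ r, ∫ x, F r * ∏ j, g (x j) ∂(iidKernel ι κ r)
        = F r * (∫ x, g x ∂κ r) ^ Fintype.card ι := by
      intro r
      change ∫ x, F r * ∏ j, g (x j) ∂(Measure.pi fun _ => κ r) = _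
      rw [integral_const_mul, integral_fintype_prod_eq_prod (fun _ => g)]
      simp
    simp only [hpi]
    rw [integral_map hH.aemeasurable]
    refine (hF.mul (Measurable.pow_const ?_ _)).aestronglyMeasurable
    exact (hg.stronglyMeasurable.integral_kernel (κ := κ)).measurable
  · refine Integrable.of_bound hm.aestronglyMeasurable 1 (Eventually.of_forall fun z => ?_)
    rw [norm_mul, norm_prod]
    exact mul_le_one₀ (hF1 _) (Finset.prod_nonneg fun _ _ => norm_nonneg _)
      (Finset.prod_le_one (fun _ _ => norm_nonneg _) fun _ _ => hg1 _)

end ConditionalLaw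

/-! ### The conditional law of one unit. -/

section UnitLaw

variable {Ω α E κ : Type*} [MeasurableSpace Ω] [MeasurableSpace α] [MeasurableSpace E]
  [Fintype κ] [MeasurableSpace κ]

/-- The law of the pair formed by an arm with law `p` and an independent noise vector with law
`ν`. -/
noncomputable def unitKernel (ν : Measure E) [IsProbabilityMeasure ν] :
    Kernel (stdSimplex ℝ κ) (κ × E) where
  toFun p := ∑ a, ENNReal.ofReal (p.1 a) • ν.map (Prod.mk a)
  measurable' := by
    refine Measure.measurable_of_measurable_coe _ fun u hu => ?_
    simp only [Measure.coe_finsetSum, Finset.sum_apply, Measure.smul_apply, smul_eq_mul]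
    refine Finset.measurable_sum _ fun a _ => Measurable.mul_const ?_ _
    exact ((measurable_pi_apply a).comp measurable_subtype_coe).ennreal_ofReal

theorem unitKernel_apply (ν : Measure E) [IsProbabilityMeasure ν] (p : stdSimplex ℝ κ) :
    unitKernel ν p = ∑ a, ENNReal.ofReal (p.1 a) • ν.map (Prod.mk a) := rfl

instance (ν : Measure E) [IsProbabilityMeasure ν] :
    IsMarkovKernel (unitKernel ν : Kernel (stdSimplex ℝ κ) (κ × E)) := by
  refine ⟨fun p => ⟨?_⟩⟩
  have h : ∀ a : κ, (ν.map (Prod.mk a)) Set.univ = 1 := fun a => by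
    rw [Measure.map_apply measurable_prodMk_left MeasurableSet.univ]; simp
  simp only [unitKernel_apply, Measure.coe_finsetSum, Finset.sum_apply, Measure.smul_apply,
    smul_eq_mul, h, mul_one]
  rw [← ENNReal.ofReal_sum_of_nonneg fun a _ => p.2.1 a, p.2.2, ENNReal.ofReal_one]

theorem unitKernel_real (ν : Measure E) [IsProbabilityMeasure ν] (p : stdSimplex ℝ κ)
    {u : Set (κ × E)} (hu : MeasurableSet u) :
    (unitKernel ν p).real u = ∑ a, p.1 a * ν.real (Prod.mk a ⁻¹' u) := by
  simp only [measureReal_def, unitKernel_apply, Measure.coe_finsetSum, Finset.sum_apply,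
    Measure.smul_apply, smul_eq_mul]
  rw [ENNReal.toReal_sum fun a _ => ENNReal.mul_ne_top ENNReal.ofReal_ne_top ?_]
  · refine Finset.sum_congr rfl fun a _ => ?_
    rw [ENNReal.toReal_mul, ENNReal.toReal_ofReal (p.2.1 a),
      Measure.map_apply measurable_prodMk_left hu]
  · rw [Measure.map_apply measurable_prodMk_left hu]
    exact measure_ne_top _ _

theorem integral_unitKernel (ν : Measure E) [IsProbabilityMeasure ν] (p : stdSimplex ℝ κ)
    {g : κ × E → ℂ} (hg : Measurable g) (hg1 : ∀ x, ‖g x‖ ≤ 1) :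
    ∫ x, g x ∂unitKernel ν p = ∑ a, (p.1 a : ℂ) * ∫ e, g (a, e) ∂ν := by
  have hint : ∀ a : κ, Integrable g (ν.map (Prod.mk a)) := fun a =>
    have := Measure.isProbabilityMeasure_map (μ := ν)
      (measurable_prodMk_left (x := a) : Measurable (Prod.mk a)).aemeasurable
    Integrable.of_bound hg.aestronglyMeasurable 1 (Eventually.of_forall hg1)
  rw [unitKernel_apply, integral_finsetSum_measure fun a _ =>
    (hint a).smul_measure ENNReal.ofReal_ne_top]
  refine Finset.sum_congr rfl fun a _ => ?_
  rw [integral_smul_measure, integral_map measurable_prodMk_left.aemeasurable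
    hg.aestronglyMeasurable, ENNReal.toReal_ofReal (p.2.1 a)]
  simp

/-- Splitting along the finitely many arms reduces `u` to rectangles. There conditional independence
gives a product: the arm factor is `p_a`, and the noise factor is constant because the noise is
independent of the past. -/
theorem condExp_prodMk_eq_unitKernel [MeasurableSingletonClass κ] {P : Measure Ω}
    [IsProbabilityMeasure P] {H : Ω → α}
    (hH : Measurable H) {A : Ω → κ} {ε : Ω → E} (hA : Measurable A) (hε : Measurable ε)
    (ν : Measure E) [IsProbabilityMeasure ν] (hν : P.map ε = ν) (hind : IndepFun ε H P)
    {p : α → stdSimplex ℝ κ}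
    (harm : ∀ a, P⟦A ⁻¹' {a} | MeasurableSpace.comap H inferInstance⟧
      =ᵐ[P] fun ω => (p (H ω)).1 a)
    (hci : CondIndepGiven H A ε P) {u : Set (κ × E)} (hu : MeasurableSet u) :
    P⟦(fun ω => (A ω, ε ω)) ⁻¹' u | MeasurableSpace.comap H inferInstance⟧
      =ᵐ[P] fun ω => (unitKernel ν (p (H ω))).real u := by
  have hm : MeasurableSpace.comap H inferInstance ≤ (inferInstance : MeasurableSpace Ω) :=
    hH.comap_le
  have hua : ∀ a : κ, MeasurableSet (Prod.mk a ⁻¹' u) := fun a => measurable_prodMk_left hu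
  have hsplit : ((fun ω => (A ω, ε ω)) ⁻¹' u).indicator (fun _ => (1 : ℝ))
      = ∑ a, (A ⁻¹' {a} ∩ ε ⁻¹' (Prod.mk a ⁻¹' u)).indicator fun _ => (1 : ℝ) := by
    ext ω
    rw [Finset.sum_apply, Finset.sum_eq_single (A ω)]
    · by_cases h : (A ω, ε ω) ∈ u <;> simp [h]
    · intro a _ ha
      simp [ha.symm]
    · simp
  rw [hsplit]
  have hsum := condExp_finsetSum (μ := P) (m := MeasurableSpace.comap H inferInstance)
    (s := Finset.univ) (f := fun a : κ =>
      (A ⁻¹' {a} ∩ ε ⁻¹' (Prod.mk a ⁻¹' u)).indicator fun _ => (1 : ℝ))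
    (fun a _ => (integrable_const 1).indicator
      ((hA (measurableSet_singleton a)).inter (hε (hua a))))
  have hconst : ∀ a : κ, P⟦ε ⁻¹' (Prod.mk a ⁻¹' u) | MeasurableSpace.comap H inferInstance⟧
      =ᵐ[P] fun _ => ν.real (Prod.mk a ⁻¹' u) := by
    intro a
    have h := condExp_indep_eq (μ := P) (f := (ε ⁻¹' (Prod.mk a ⁻¹' u)).indicator fun _ => (1 : ℝ))
      hε.comap_le hm
      (stronglyMeasurable_const.indicator ⟨_, hua a, rfl⟩) hind
    refine h.trans (Eventually.of_forall fun ω => ?_)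
    simp only
    rw [integral_indicator_const _ (hε (hua a)), ← hν, map_measureReal_apply hε (hua a)]
    simp
  filter_upwards [hsum, ae_all_iff.2 harm, ae_all_iff.2 hconst,
    ae_all_iff.2 fun a => hci {a} (Prod.mk a ⁻¹' u) (measurableSet_singleton a) (hua a)]
    with ω h1 h2 h3 h4
  rw [h1, Finset.sum_apply, unitKernel_real ν _ hu]
  exact Finset.sum_congr rfl fun a _ => by rw [h4 a, h2 a, h3 a]

end UnitLaw

end GaussianSequentialExperiment

namespace GaussianSequentialExperiment

/-! ### Estimates for powers of characteristic functions. -/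

section Asymptotics

theorem norm_pow_sub_pow_le_mul {x y : ℂ} (hx : ‖x‖ ≤ 1) (hy : ‖y‖ ≤ 1) (N : ℕ) :
    ‖x ^ N - y ^ N‖ ≤ N * ‖x - y‖ := by
  induction N with
  | zero => simp
  | succ N ih =>
    have h : x ^ (N + 1) - y ^ (N + 1) = (x ^ N - y ^ N) * x + y ^ N * (x - y) := by ring
    rw [h]
    refine (norm_add_le _ _).trans ?_
    rw [norm_mul, norm_mul, norm_pow]
    have h1 : ‖x ^ N - y ^ N‖ * ‖x‖ ≤ ‖x ^ N - y ^ N‖ := mul_le_of_le_one_right (norm_nonneg _) hx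
    have h2 : ‖y‖ ^ N * ‖x - y‖ ≤ ‖x - y‖ :=
      mul_le_of_le_one_left (norm_nonneg _) (pow_le_one₀ (norm_nonneg _) hy)
    push_cast
    linarith

/-- Mean value inequality on the convex left half-plane, where the derivative of `exp` has norm at
most 1. -/
theorem norm_exp_sub_exp_le_of_re_nonpos {x y : ℂ} (hx : x.re ≤ 0) (hy : y.re ≤ 0) :
    ‖Complex.exp x - Complex.exp y‖ ≤ ‖x - y‖ := by
  have h := (convex_halfSpace_re_le 0).norm_image_sub_le_of_norm_hasDerivWithin_le
    (f := Complex.exp) (f' := Complex.exp) (C := 1)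
    (fun z _ => (Complex.hasDerivAt_exp z).hasDerivWithinAt)
    (fun z hz => by rw [Complex.norm_exp]; exact Real.exp_le_one_iff.2 hz) hy hx
  simpa using h

/-- Taylor's bound covers `|x| ≤ 1`. For `|x| ≥ 1` the triangle inequality gives `2 + |x| + |x| ^ 2
/ 2`, at most `7/2 * |x| ^ 3`, whence the constant 4. -/
theorem norm_exp_ofReal_mul_I_sub_le (x : ℝ) :
    ‖Complex.exp (x * Complex.I) - (1 + x * Complex.I - x ^ 2 / 2)‖ ≤ 4 * |x| ^ 3 := by
  have hn : ‖(x : ℂ) * Complex.I‖ = |x| := by simp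
  have hsq : ((x : ℂ) * Complex.I) ^ 2 = -(x : ℂ) ^ 2 := by rw [mul_pow, Complex.I_sq]; ring
  rcases le_total |x| 1 with hx | hx
  · have h := Complex.exp_bound (x := x * Complex.I) (by rw [hn]; exact hx) (n := 3) (by norm_num)
    rw [hn] at h
    have hs : ∑ m ∈ Finset.range 3, ((x : ℂ) * Complex.I) ^ m / (m.factorial : ℂ)
        = 1 + x * Complex.I - x ^ 2 / 2 := by
      simp only [Finset.sum_range_succ, Finset.sum_range_zero, hsq]
      norm_num
      ring
    rw [hs] at h
    refine h.trans ?_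
    have : 0 ≤ |x| ^ 3 := by positivity
    norm_num [Nat.factorial]
    linarith
  · have h1 : ‖Complex.exp (x * Complex.I)‖ = 1 := Complex.norm_exp_ofReal_mul_I x
    have h2 : ‖(1 : ℂ) + x * Complex.I - x ^ 2 / 2‖ ≤ 1 + |x| + |x| ^ 2 / 2 := by
      refine (norm_sub_le _ _).trans (add_le_add ((norm_add_le _ _).trans ?_) ?_)
      · rw [hn]; simp
      · simp
    have h3 : |x| ≤ |x| ^ 3 := by nlinarith [abs_nonneg x, sq_nonneg (|x| - 1)]
    have h4 : |x| ^ 2 ≤ |x| ^ 3 := by nlinarith [abs_nonneg x, sq_nonneg |x|]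
    refine (norm_sub_le _ _).trans ?_
    rw [h1]
    linarith

/-- The second-order Taylor error is integrated using `|x| ^ 3 ≤ 1 + x ^ 4`. The bound depends on
the law only through `C`, so it serves noise laws that vary with `n`. -/
theorem norm_charFun_sub_le_of_fourth_moment {α : Type*} [MeasurableSpace α] {ν : Measure α}
    [IsProbabilityMeasure ν] {X : α → ℝ} (hX : Measurable X) {C : ℝ}
    (h4 : Integrable (fun e => X e ^ 4) ν) (hC : ∫ e, X e ^ 4 ∂ν ≤ C)
    (h0 : ∫ e, X e ∂ν = 0) {v : ℝ} (hv : ∫ e, X e ^ 2 ∂ν = v) (c : ℝ) :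
    ‖∫ e, Complex.exp ((c * X e : ℝ) * Complex.I) ∂ν - (1 - (c ^ 2 * v / 2 : ℝ))‖
      ≤ 4 * |c| ^ 3 * (1 + C) := by
  have hdom : Integrable (fun e => 1 + X e ^ 4) ν := (integrable_const 1).add h4
  have key : ∀ x : ℝ, |x| ≤ 1 + x ^ 4 ∧ x ^ 2 ≤ 1 + x ^ 4 ∧ |x| ^ 3 ≤ 1 + x ^ 4 := by
    intro x
    have hx : x ^ 4 = |x| ^ 4 := by rw [← abs_pow, abs_of_nonneg (by positivity)]
    have hx2 : x ^ 2 = |x| ^ 2 := by simp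
    rw [hx, hx2]
    have h := abs_nonneg x
    rcases le_total |x| 1 with h1 | h1
    · have : 0 ≤ |x| ^ 4 := by positivity
      exact ⟨by linarith, by linarith [pow_le_one₀ h h1 (n := 2)],
        by linarith [pow_le_one₀ h h1 (n := 3)]⟩
    · exact ⟨by linarith [le_self_pow₀ h1 (n := 4) (by norm_num)],
        by linarith [pow_le_pow_right₀ h1 (show 2 ≤ 4 by norm_num)],
        by linarith [pow_le_pow_right₀ h1 (show 3 ≤ 4 by norm_num)]⟩
  have i1 : Integrable X ν := hdom.mono' hX.aestronglyMeasurable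
    (Eventually.of_forall fun e => (key (X e)).1)
  have i2 : Integrable (fun e => X e ^ 2) ν := hdom.mono' (hX.pow_const 2).aestronglyMeasurable
    (Eventually.of_forall fun e => by
      rw [Real.norm_of_nonneg (sq_nonneg _)]; exact (key (X e)).2.1)
  have iexp : Integrable (fun e => Complex.exp ((c * X e : ℝ) * Complex.I)) ν :=
    Integrable.of_bound (by fun_prop) 1
      (Eventually.of_forall fun e => (Complex.norm_exp_ofReal_mul_I _).le)
  have ia : Integrable (fun e => ((c * X e : ℝ) : ℂ) * Complex.I) ν :=
    ((i1.const_mul c).ofReal (𝕜 := ℂ)).mul_const _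
  have ib : Integrable (fun e => (((c * X e) ^ 2 / 2 : ℝ) : ℂ)) ν := by
    refine Integrable.ofReal (𝕜 := ℂ) ?_
    simp only [mul_pow]
    exact (i2.const_mul _).div_const 2
  have ipoly : Integrable (fun e => 1 + ((c * X e : ℝ) : ℂ) * Complex.I
      - (((c * X e) ^ 2 / 2 : ℝ) : ℂ)) ν := ((integrable_const 1).add ia).sub ib
  have hpoly : ∫ e, (1 + ((c * X e : ℝ) : ℂ) * Complex.I - (((c * X e) ^ 2 / 2 : ℝ) : ℂ)) ∂ν
      = 1 - (c ^ 2 * v / 2 : ℝ) := by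
    have i1a : Integrable (fun e => 1 + ((c * X e : ℝ) : ℂ) * Complex.I) ν :=
      (integrable_const 1).add ia
    rw [integral_sub i1a ib, integral_add (integrable_const 1) ia,
      integral_mul_const, integral_complex_ofReal, integral_complex_ofReal, integral_const_mul, h0]
    simp only [mul_pow]
    rw [integral_div, integral_const_mul, hv]
    simp
  rw [← hpoly, ← integral_sub iexp ipoly]
  refine (norm_integral_le_integral_norm _).trans ?_
  calc ∫ e, ‖Complex.exp ((c * X e : ℝ) * Complex.I) - (1 + ((c * X e : ℝ) : ℂ) * Complex.I
        - (((c * X e) ^ 2 / 2 : ℝ) : ℂ))‖ ∂ν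
      ≤ ∫ e, 4 * |c| ^ 3 * (1 + X e ^ 4) ∂ν := by
        refine integral_mono (iexp.sub ipoly).norm (hdom.const_mul _) fun e => ?_
        have h := norm_exp_ofReal_mul_I_sub_le (c * X e)
        push_cast at h ⊢
        refine h.trans ?_
        rw [abs_mul, mul_pow, mul_assoc]
        gcongr
        exact (key (X e)).2.2
    _ ≤ 4 * |c| ^ 3 * (1 + C) := by
        rw [integral_const_mul, integral_add (integrable_const 1) h4]
        simp only [integral_const, probReal_univ, smul_eq_mul, mul_one]
        gcongr

/-- Powers of mixtures of characteristic functions converge uniformly in the mixture weights. -/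
theorem exists_tendsto_zero_norm_mixture_pow_sub_le {κ : Type*} [Fintype κ] {ψ : ℕ → κ → ℂ}
    (hψ : ∀ n a, ‖ψ n a‖ ≤ 1) {m : κ → ℂ} (hm : ∀ a, (m a).re ≤ 0)
    (h : ∀ a, Tendsto (fun n : ℕ => (n : ℂ) * (ψ n a - 1)) atTop (𝓝 (m a)))
    {N : ℕ → ℕ} {b : ℝ} (hb : 0 ≤ b) (hN : Tendsto (fun n => (N n : ℝ) / n) atTop (𝓝 b)) :
    ∃ δ : ℕ → ℝ, Tendsto δ atTop (𝓝 0) ∧ ∀ᶠ n in atTop, ∀ p : stdSimplex ℝ κ,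
      ‖(∑ a, (p.1 a : ℂ) * ψ n a) ^ N n - Complex.exp (b * ∑ a, (p.1 a : ℂ) * m a)‖ ≤ δ n := by
  set M : ℝ := ∑ a, ‖m a‖ with hMdef
  have hM0 : 0 ≤ M := Finset.sum_nonneg fun _ _ => norm_nonneg _
  have hp1 : ∀ (p : stdSimplex ℝ κ) a, p.1 a ≤ 1 := fun p a =>
    p.2.2 ▸ Finset.single_le_sum (fun i _ => p.2.1 i) (Finset.mem_univ a)
  have hbound : ∀ (p : stdSimplex ℝ κ) (z : κ → ℂ), ‖∑ a, (p.1 a : ℂ) * z a‖ ≤ ∑ a, ‖z a‖ := by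
    intro p z
    refine (norm_sum_le _ _).trans (Finset.sum_le_sum fun a _ => ?_)
    rw [norm_mul, Complex.norm_of_nonneg (p.2.1 a)]
    exact mul_le_of_le_one_left (norm_nonneg _) (hp1 p a)
  have hre : ∀ p : stdSimplex ℝ κ, (∑ a, (p.1 a : ℂ) * m a).re ≤ 0 := by
    intro p
    rw [Complex.re_sum]
    refine Finset.sum_nonpos fun a _ => ?_
    rw [Complex.re_ofReal_mul]
    exact mul_nonpos_of_nonneg_of_nonpos (p.2.1 a) (hm a)
  -- Three errors: the one-unit expansion, the replacement of `1 + q / n` by `exp (q / n)` (at most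
  -- `(M / n) ^ 2` per unit), and `N n / n` in place of `b`. None depends on `p`, as `‖q‖ ≤ M` for
  -- all weights.
  refine ⟨fun n => (N n : ℝ) / n * (∑ a, ‖(n : ℂ) * (ψ n a - 1) - m a‖ + M ^ 2 * (n : ℝ)⁻¹)
    + ‖(N n : ℝ) / n - b‖ * M, ?_, ?_⟩
  · have h1 : Tendsto (fun n : ℕ => ∑ a, ‖(n : ℂ) * (ψ n a - 1) - m a‖) atTop (𝓝 0) := by
      rw [show (0 : ℝ) = ∑ _a : κ, 0 by simp]
      exact tendsto_finsetSum _ fun a _ => tendsto_iff_norm_sub_tendsto_zero.1 (h a)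
    have h2 : Tendsto (fun n : ℕ => M ^ 2 * (n : ℝ)⁻¹) atTop (𝓝 0) := by
      simpa using (tendsto_inv_atTop_nhds_zero_nat (𝕜 := ℝ)).const_mul (M ^ 2)
    have h3 : Tendsto (fun n : ℕ => ‖(N n : ℝ) / n - b‖ * M) atTop (𝓝 0) := by
      simpa using (tendsto_iff_norm_sub_tendsto_zero.1 hN).mul_const M
    simpa using (hN.mul (h1.add h2)).add h3
  -- The condition `n ≥ M` ensures `‖q / n‖ ≤ 1`, as the quadratic bound on `exp` requires.
  · filter_upwards [eventually_ge_atTop 1, eventually_ge_atTop ⌈M⌉₊] with n hn hnM p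
    have hn0 : (0 : ℝ) < n := by exact_mod_cast hn
    have hnc : (n : ℂ) ≠ 0 := by exact_mod_cast hn0.ne'
    have hMn : M ≤ n := Nat.ceil_le.1 hnM
    set q : ℂ := ∑ a, (p.1 a : ℂ) * m a with hq
    set φ : ℂ := ∑ a, (p.1 a : ℂ) * ψ n a with hφ
    have hqM : ‖q‖ ≤ M := hbound p m
    have hsum : (∑ a, (p.1 a : ℂ)) = 1 := by exact_mod_cast p.2.2
    have hφ1 : ‖φ‖ ≤ 1 := by
      refine (norm_sum_le _ _).trans ?_
      rw [← p.2.2]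
      refine Finset.sum_le_sum fun a _ => ?_
      rw [norm_mul, Complex.norm_of_nonneg (p.2.1 a)]
      exact mul_le_of_le_one_right (p.2.1 a) (hψ n a)
    have hqn : ‖q / n‖ = ‖q‖ / n := by rw [norm_div, Complex.norm_natCast]
    have hexp1 : ‖Complex.exp (q / n)‖ ≤ 1 := by
      rw [Complex.norm_exp, Real.exp_le_one_iff, Complex.div_natCast_re]
      exact div_nonpos_of_nonpos_of_nonneg (hre p) hn0.le
    have hdiff : φ - 1 - q / n = (∑ a, (p.1 a : ℂ) * ((n : ℂ) * (ψ n a - 1) - m a)) / n := by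
      have hone : φ - 1 = ∑ a, (p.1 a : ℂ) * (ψ n a - 1) := by
        simp_rw [mul_sub, mul_one, Finset.sum_sub_distrib, hsum, hφ]
      rw [hone, hq, eq_div_iff hnc, sub_mul, div_mul_cancel₀ _ hnc, Finset.sum_mul,
        ← Finset.sum_sub_distrib]
      exact Finset.sum_congr rfl fun a _ => by ring
    have hA : ‖φ - Complex.exp (q / n)‖
        ≤ (∑ a, ‖(n : ℂ) * (ψ n a - 1) - m a‖) / n + (M / n) ^ 2 := by
      have hs : φ - Complex.exp (q / n)
          = (φ - 1 - q / n) - (Complex.exp (q / n) - 1 - q / n) := by ring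
      rw [hs]
      refine (norm_sub_le _ _).trans (add_le_add ?_ ?_)
      · rw [hdiff, norm_div, Complex.norm_natCast]
        gcongr
        exact hbound p _
      · refine (Complex.norm_exp_sub_one_sub_id_le ?_).trans ?_
        · rw [hqn, div_le_one hn0]; exact hqM.trans hMn
        · rw [hqn]; gcongr
    have hB : ‖φ ^ N n - Complex.exp (q / n) ^ N n‖
        ≤ (N n : ℝ) / n * (∑ a, ‖(n : ℂ) * (ψ n a - 1) - m a‖ + M ^ 2 * (n : ℝ)⁻¹) := by
      refine (norm_pow_sub_pow_le_mul hφ1 hexp1 _).trans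
        ((mul_le_mul_of_nonneg_left hA (Nat.cast_nonneg _)).trans (le_of_eq ?_))
      field_simp
    have hC : ‖Complex.exp (q / n) ^ N n - Complex.exp (b * q)‖ ≤ ‖(N n : ℝ) / n - b‖ * M := by
      rw [← Complex.exp_nat_mul]
      have h1 : (N n : ℂ) * (q / n) = (((N n : ℝ) / n : ℝ) : ℂ) * q := by
        push_cast; ring
      rw [h1]
      refine (norm_exp_sub_exp_le_of_re_nonpos ?_ ?_).trans ?_
      · rw [Complex.re_ofReal_mul]
        exact mul_nonpos_of_nonneg_of_nonpos (by positivity) (hre p)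
      · rw [Complex.re_ofReal_mul]
        exact mul_nonpos_of_nonneg_of_nonpos hb (hre p)
      · rw [← sub_mul, norm_mul, ← Complex.ofReal_sub, Complex.norm_real]
        gcongr
    exact (norm_sub_le_norm_sub_add_norm_sub _ _ _).trans (add_le_add hB hC)

theorem tendsto_natCast_mul_exp_div_sub_one (z : ℂ) :
    Tendsto (fun n : ℕ => (n : ℂ) * (Complex.exp (z / n) - 1)) atTop (𝓝 z) := by
  have hd : HasDerivAt (fun w : ℂ => Complex.exp (z * w)) z 0 := by
    have h := ((hasDerivAt_id (0 : ℂ)).const_mul z).cexp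
    simpa using h
  have hs := hasDerivAt_iff_tendsto_slope_zero.1 hd
  have hlim : Tendsto (fun n : ℕ => ((n : ℂ))⁻¹) atTop (𝓝[≠] 0) := by
    refine tendsto_nhdsWithin_iff.2 ⟨tendsto_inv_atTop_nhds_zero_nat (𝕜 := ℂ), ?_⟩
    filter_upwards [eventually_ge_atTop 1] with n hn
    have : (n : ℂ) ≠ 0 := by exact_mod_cast (by omega : n ≠ 0)
    simpa using this
  refine (hs.comp hlim).congr fun n => ?_
  simp [div_eq_mul_inv]

end Asymptotics

/-! ### One-unit expansion under the noise law. -/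

section NoiseLaw

variable {K : ℕ} {s : Fin K → ℝ} {C : ℝ≥0} {ν : Measure (Fin K → ℝ)}

theorem IsNoiseLaw.integrable_pow_four (hν : IsNoiseLaw s C ν) (a : Fin K) :
    Integrable (fun e => e a ^ 4) ν ∧ ∫ e, e a ^ 4 ∂ν ≤ C := by
  have hm : Measurable fun e : Fin K → ℝ => e a ^ 4 := (measurable_pi_apply a).pow_const 4
  have hle : ∫⁻ e, ‖e a ^ 4‖ₑ ∂ν ≤ C := by
    refine le_trans (lintegral_mono fun e => ?_) hν.fourth_moment
    rw [enorm_pow]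
    gcongr
    rw [enorm_le_iff_norm_le]
    exact PiLp.norm_apply_le (WithLp.toLp 2 e) a
  have hi : Integrable (fun e => e a ^ 4) ν :=
    ⟨hm.aestronglyMeasurable, hle.trans_lt ENNReal.coe_lt_top⟩
  refine ⟨hi, ?_⟩
  have h := ofReal_integral_norm_eq_lintegral_enorm hi
  have hnorm : ∀ e : Fin K → ℝ, ‖e a ^ 4‖ = e a ^ 4 := fun e =>
    Real.norm_of_nonneg (by positivity)
  simp only [hnorm] at h
  rw [← h] at hle
  rw [← ENNReal.ofReal_coe_nnreal] at hle
  exact (ENNReal.ofReal_le_ofReal_iff C.2).1 hle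

theorem IsNoiseLaw.integral_sq (hν : IsNoiseLaw s C ν) (a : Fin K) :
    ∫ e, e a ^ 2 ∂ν = s a ^ 2 := by
  rw [← hν.variance a, variance_of_integral_eq_zero (measurable_pi_apply a).aemeasurable
    (hν.mean_zero a)]

/-- The expansion of the characteristic function of the contribution of one unit to
`√n R̄_{t,a}`. -/
theorem IsNoiseLaw.tendsto_natCast_mul_integral_exp_sub_one {ν : ℕ → Measure (Fin K → ℝ)}
    (hν : ∀ n, IsNoiseLaw s C (ν n)) (h : Fin K → ℝ) (a : Fin K) (c : ℝ) :
    Tendsto (fun n : ℕ => (n : ℂ) *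
      (∫ e, Complex.exp ((c / √(n : ℝ) * reward h n e a : ℝ) * Complex.I) ∂ν n - 1)) atTop
      (𝓝 ((c * h a : ℝ) * Complex.I - (c ^ 2 * s a ^ 2 / 2 : ℝ))) := by
  set z : ℂ := (c * h a : ℝ) * Complex.I with hz
  let f : ℕ → ℂ := fun n => ∫ e, Complex.exp ((c / √(n : ℝ) * e a : ℝ) * Complex.I) ∂ν n
  have hf : Tendsto (fun n : ℕ => (n : ℂ) * (f n - 1)) atTop
      (𝓝 (-(c ^ 2 * s a ^ 2 / 2 : ℝ))) := by
    rw [tendsto_iff_norm_sub_tendsto_zero]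
    have hlim : Tendsto (fun n : ℕ => 4 * |c| ^ 3 * (1 + (C : ℝ)) * (√(n : ℝ))⁻¹) atTop (𝓝 0) := by
      simpa using (tendsto_inv_atTop_zero.comp
        (Real.tendsto_sqrt_atTop.comp tendsto_natCast_atTop_atTop)).const_mul
          (4 * |c| ^ 3 * (1 + (C : ℝ)))
    refine squeeze_zero' (Eventually.of_forall fun _ => norm_nonneg _) ?_ hlim
    filter_upwards [eventually_ge_atTop 1] with n hn
    have hn0 : (0 : ℝ) < n := by exact_mod_cast hn
    have hnc : (n : ℂ) ≠ 0 := by exact_mod_cast hn0.ne'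
    have := (hν n).isProbabilityMeasure
    have h4 := (hν n).integrable_pow_four a
    have hb := norm_charFun_sub_le_of_fourth_moment (measurable_pi_apply a) h4.1 h4.2
      ((hν n).mean_zero a) ((hν n).integral_sq a) (c / √(n : ℝ))
    have hsq : √(n : ℝ) ^ 2 = n := Real.sq_sqrt hn0.le
    have hsc : ((c / √(n : ℝ)) ^ 2 * s a ^ 2 / 2 : ℝ) = (c ^ 2 * s a ^ 2 / 2) / n := by
      rw [div_pow, hsq]; ring
    rw [hsc] at hb
    have heq : (n : ℂ) * (f n - 1) - (-(c ^ 2 * s a ^ 2 / 2 : ℝ) : ℂ)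
        = n * (f n - (1 - ((c ^ 2 * s a ^ 2 / 2) / n : ℝ))) := by
      push_cast
      field_simp
      ring
    rw [heq, norm_mul, Complex.norm_natCast]
    refine (mul_le_mul_of_nonneg_left hb hn0.le).trans (le_of_eq ?_)
    rw [abs_div, abs_of_nonneg (Real.sqrt_nonneg _), div_pow]
    have hs0 : √(n : ℝ) ≠ 0 := (Real.sqrt_pos.2 hn0).ne'
    nth_rewrite 1 [← hsq]
    field_simp
  have hexp0 : Tendsto (fun n : ℕ => Complex.exp (z / n)) atTop (𝓝 1) := by
    have : Tendsto (fun n : ℕ => z / n) atTop (𝓝 0) := by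
      simpa [div_eq_mul_inv] using (tendsto_inv_atTop_nhds_zero_nat (𝕜 := ℂ)).const_mul z
    simpa [Function.comp_def] using (Complex.continuous_exp.tendsto 0).comp this
  -- The deterministic drift factors out as `exp (z / n)`, and `n (exp (z / n) f - 1) = n (exp (z /
  -- n) - 1) + exp (z / n) * (n (f - 1))`.
  have hmain := (tendsto_natCast_mul_exp_div_sub_one z).add (hexp0.mul hf)
  rw [one_mul, ← sub_eq_add_neg] at hmain
  refine hmain.congr' ?_
  filter_upwards [eventually_ge_atTop 1] with n hn
  have hn0 : (0 : ℝ) < n := by exact_mod_cast hn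
  have hs : √(n : ℝ) * √(n : ℝ) = n := Real.mul_self_sqrt hn0.le
  have hs0 : √(n : ℝ) ≠ 0 := (Real.sqrt_pos.2 hn0).ne'
  have hint : ∫ e, Complex.exp ((c / √(n : ℝ) * reward h n e a : ℝ) * Complex.I) ∂ν n
      = Complex.exp (z / n) * f n := by
    rw [← integral_const_mul]
    congr 1 with e
    rw [← Complex.exp_add]
    congr 1
    have h1 : c / √(n : ℝ) * reward h n e a = c * h a / n + c / √(n : ℝ) * e a := by
      have h2 : h a / n = h a / √(n : ℝ) / √(n : ℝ) := by rw [div_div, hs]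
      rw [reward, mul_div_assoc, h2]
      ring
    rw [h1, hz]
    push_cast
    ring
  rw [hint]
  ring

end NoiseLaw

end GaussianSequentialExperiment

/-! ### Characteristic functions of the Gaussian and batched experiments. -/

namespace GaussianSequentialExperiment

variable {K T : ℕ}

/-- The exponent of the characteristic function, at `v`, of the Gaussian observation from an epoch
with batch constant `c` in which only the arm `a` is drawn, divided by `c`. -/
noncomputable def armExponent (h s : Fin K → ℝ) (c : ℝ) (v : Fin K → ℝ) (a : Fin K) : ℂ :=
  (v a / c * h a : ℝ) * Complex.I - ((v a / c) ^ 2 * s a ^ 2 / 2 : ℝ)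

theorem armExponent_re_nonpos (h s : Fin K → ℝ) (c : ℝ) (v : Fin K → ℝ) (a : Fin K) :
    (armExponent h s c v a).re ≤ 0 := by
  rw [armExponent, Complex.sub_re, Complex.re_ofReal_mul, Complex.I_re, Complex.ofReal_re]
  have : 0 ≤ (v a / c) ^ 2 * s a ^ 2 / 2 := by positivity
  linarith

theorem integral_exp_gaussianObs (h s : Fin K → ℝ) {c : ℝ} (hc : 0 < c)
    (p : stdSimplex ℝ (Fin K)) (v : Fin K → ℝ) :
    ∫ x, Complex.exp ((∑ a, v a * x a : ℝ) * Complex.I) ∂gaussianObs h s c p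
      = Complex.exp (c * ∑ a, (p.1 a : ℂ) * armExponent h s c v a) := by
  have hprod : ∀ x : Fin K → ℝ, Complex.exp ((∑ a, v a * x a : ℝ) * Complex.I)
      = ∏ a, Complex.exp ((v a : ℂ) * (x a : ℂ) * Complex.I) := by
    intro x
    rw [← Complex.exp_sum, ← Finset.sum_mul]
    push_cast
    rfl
  simp only [hprod, gaussianObs]
  rw [integral_fintype_prod_eq_prod
    (fun a (x : ℝ) => Complex.exp ((v a : ℂ) * (x : ℂ) * Complex.I)), Finset.mul_sum,
    Complex.exp_sum]
  refine Finset.prod_congr rfl fun a _ => ?_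
  rw [← charFun_apply_real, charFun_gaussianReal]
  congr 1
  have hpa : 0 ≤ p.1 a := p.2.1 a
  have hvar : 0 ≤ p.1 a * s a ^ 2 / c := by positivity
  have hcc : (c : ℂ) ≠ 0 := by exact_mod_cast hc.ne'
  change (v a : ℂ) * ((p.1 a * h a : ℝ) : ℂ) * Complex.I
    - (((p.1 a * s a ^ 2 / c).toNNReal : ℝ) : ℂ) * (v a : ℂ) ^ 2 / 2 = _
  rw [Real.coe_toNNReal _ hvar, armExponent]
  push_cast
  field_simp

theorem norm_exp_mul_sum_armExponent_le_one (h s : Fin K → ℝ) {c : ℝ} (hc : 0 < c)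
    (p : stdSimplex ℝ (Fin K)) (v : Fin K → ℝ) :
    ‖Complex.exp (c * ∑ a, (p.1 a : ℂ) * armExponent h s c v a)‖ ≤ 1 := by
  rw [Complex.norm_exp, Real.exp_le_one_iff, Complex.re_ofReal_mul, Complex.re_sum]
  refine mul_nonpos_of_nonneg_of_nonpos hc.le (Finset.sum_nonpos fun a _ => ?_)
  rw [Complex.re_ofReal_mul]
  exact mul_nonpos_of_nonneg_of_nonpos (p.2.1 a) (armExponent_re_nonpos h s c v a)

theorem measurable_past {E : Type*} [MeasurableSpace E] (t : Fin T) :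
    Measurable fun x : Fin T → E => past x t :=
  measurable_pi_lambda _ fun _ => measurable_pi_apply _

/-- Integrating out `G_t` leaves an integral over the past alone, the form in which the induction
hypothesis can be used. -/
theorem IsGaussianSequentialExperiment.integral_mul_exp {Ω : Type*} [MeasurableSpace Ω]
    {b : Fin T → ℝ} (hb : ∀ t, 0 < b t) {h s : Fin K → ℝ} {π : Policy K T}
    {G : Ω → Fin T → Fin K → ℝ} {Q : Measure Ω} [IsProbabilityMeasure Q]
    (hG : IsGaussianSequentialExperiment b h s π G Q) (t : Fin T)
    {F : (Fin t → Fin K → ℝ) → ℂ} (hF : Measurable F) (hF1 : ∀ r, ‖F r‖ ≤ 1) (v : Fin K → ℝ) :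
    ∫ ω, F (past (G ω) t) * Complex.exp ((∑ a, v a * G ω t a : ℝ) * Complex.I) ∂Q
      = ∫ r, F r * Complex.exp (b t * ∑ a, ((π t r).1 a : ℂ) * armExponent h s (b t) v a)
          ∂(Q.map fun ω => past (G ω) t) := by
  have hH : Measurable fun ω => past (G ω) t := (measurable_past t).comp hG.measurable
  have hY : Measurable fun ω => G ω t := (measurable_pi_apply t).comp hG.measurable
  have : IsProbabilityMeasure (Q.map fun ω => past (G ω) t) :=
    Measure.isProbabilityMeasure_map hH.aemeasurable
  have hm : Measurable fun z : (Fin t → Fin K → ℝ) × (Fin K → ℝ) =>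
      F z.1 * Complex.exp ((∑ a, v a * z.2 a : ℝ) * Complex.I) := by fun_prop
  have hmap : ∫ ω, F (past (G ω) t) * Complex.exp ((∑ a, v a * G ω t a : ℝ) * Complex.I) ∂Q
      = ∫ z, F z.1 * Complex.exp ((∑ a, v a * z.2 a : ℝ) * Complex.I)
          ∂(Q.map fun ω => (past (G ω) t, G ω t)) := by
    rw [integral_map (hH.prodMk hY).aemeasurable hm.aestronglyMeasurable]
  rw [hmap, ← compProd_map_condDistrib hY.aemeasurable, Measure.integral_compProd]
  · refine integral_congr_ae ?_
    filter_upwards [hG.cond_law t] with r hr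
    rw [hr, integral_const_mul, integral_exp_gaussianObs h s (hb t)]
  · refine Integrable.of_bound hm.aestronglyMeasurable 1 (Eventually.of_forall fun z => ?_)
    rw [norm_mul, Complex.norm_exp_ofReal_mul_I, mul_one]
    exact hF1 _

theorem sum_mul_scaledMeans_eq_sum_unit {Ω : Type*} {b : Fin T → ℝ} {h : Fin K → ℝ} {n : ℕ}
    {A : (t : Fin T) → Fin (batchSize b n t) → Ω → Fin K}
    {ε : (t : Fin T) → Fin (batchSize b n t) → Ω → Fin K → ℝ} (v : Fin K → ℝ) (t : Fin T) (ω : Ω) :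
    ∑ a, v a * scaledMeans b h n A ε ω t a
      = ∑ j, v (A t j ω) / b t / √(n : ℝ) * reward h n (ε t j ω) (A t j ω) := by
  -- This also holds at `n = 0`, where both sides vanish.
  have hn : √(n : ℝ) * (b t * n)⁻¹ = (b t)⁻¹ * (√(n : ℝ))⁻¹ := by
    rw [mul_inv, mul_left_comm, ← div_eq_mul_inv (√(n : ℝ)), Real.sqrt_div_self', one_div]
  simp only [scaledMeans, batchMean, Finset.mul_sum]
  rw [Finset.sum_comm]
  refine Finset.sum_congr rfl fun j _ => ?_
  rw [Finset.sum_eq_single (A t j ω)]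
  · simp only [pulled, if_true, one_mul]
    rw [← mul_assoc (√(n : ℝ)), hn]
    ring
  · intro a _ ha
    simp [pulled, ha.symm]
  · simp

section BatchedExperiment

variable {Ω : Type*} [MeasurableSpace Ω] {b : Fin T → ℝ} {h : Fin K → ℝ} {π : Policy K T} {n : ℕ}
  {ν : Measure (Fin K → ℝ)} {A : (t : Fin T) → Fin (batchSize b n t) → Ω → Fin K}
  {ε : (t : Fin T) → Fin (batchSize b n t) → Ω → Fin K → ℝ} {P : Measure Ω}

theorem measurable_reward (h : Fin K → ℝ) (n : ℕ) : Measurable (reward h n) := by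
  unfold reward
  fun_prop

theorem IsBatchedExperiment.measurable_scaledMeans (hE : IsBatchedExperiment b h π n ν A ε P) :
    Measurable (scaledMeans b h n A ε) := by
  refine measurable_pi_lambda _ fun t => measurable_pi_lambda _ fun a => ?_
  refine Measurable.const_mul (Measurable.const_mul (Finset.measurable_sum _ fun j _ => ?_) _) _
  refine Measurable.mul ?_ ?_
  · exact (measurable_of_finite fun x : Fin K => pulled x a).comp (hE.measurable_arm t j)
  · exact (measurable_pi_apply a).comp ((measurable_reward h n).comp (hE.measurable_noise t j))

theorem IsBatchedExperiment.condIndepGiven_noise (hE : IsBatchedExperiment b h π n ν A ε P)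
    (t : Fin T) (j : Fin (batchSize b n t)) :
    CondIndepGiven (pastMeans b h n A ε t) (A t j) (ε t j) P := by
  intro u w hu hw
  -- Rewards are a deterministic translate of the noise, so ignorability transfers by undoing the
  -- shift.
  have hsub : Measurable fun x : Fin K → ℝ => fun a => x a - h a / √(n : ℝ) := by fun_prop
  have hpre : (fun ω => reward h n (ε t j ω)) ⁻¹' ((fun x a => x a - h a / √(n : ℝ)) ⁻¹' w)
      = ε t j ⁻¹' w := by
    ext ω
    simp [reward]
  have := hE.ignorability t j u _ hu (hsub hw)
  rwa [hpre] at this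

/-- The characteristic function of the scaled batch means of an epoch, given the past. -/
theorem IsBatchedExperiment.integral_mul_exp [IsProbabilityMeasure P] [IsProbabilityMeasure ν]
    (hE : IsBatchedExperiment b h π n ν A ε P) (t : Fin T) (hπ : Measurable (π t))
    {F : (Fin t → Fin K → ℝ) → ℂ} (hF : Measurable F) (hF1 : ∀ r, ‖F r‖ ≤ 1) (v : Fin K → ℝ) :
    ∫ ω, F (pastMeans b h n A ε t ω)
        * Complex.exp ((∑ a, v a * scaledMeans b h n A ε ω t a : ℝ) * Complex.I) ∂P
      = ∫ ω, F (pastMeans b h n A ε t ω) * (∑ a, ((π t (pastMeans b h n A ε t ω)).1 a : ℂ) *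
          ∫ e, Complex.exp ((v a / b t / √(n : ℝ) * reward h n e a : ℝ) * Complex.I) ∂ν)
            ^ batchSize b n t ∂P := by
  have hH : Measurable (pastMeans b h n A ε t) :=
    (measurable_past t).comp hE.measurable_scaledMeans
  let g : Fin K × (Fin K → ℝ) → ℂ := fun z =>
    Complex.exp ((v z.1 / b t / √(n : ℝ) * reward h n z.2 z.1 : ℝ) * Complex.I)
  have hg : Measurable g := by
    refine measurable_from_prod_countable_right fun a => ?_
    have : Measurable fun e => reward h n e a :=
      (measurable_pi_apply a).comp (measurable_reward h n)
    change Measurable fun e =>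
      Complex.exp ((v a / b t / √(n : ℝ) * reward h n e a : ℝ) * Complex.I)
    fun_prop
  have hg1 : ∀ z, ‖g z‖ ≤ 1 := fun z => (Complex.norm_exp_ofReal_mul_I _).le
  have key := integral_mul_prod_eq_integral_mul_pow hH
    (fun j => (hE.measurable_arm t j).prodMk (hE.measurable_noise t j))
    ((unitKernel ν).comap (π t) hπ) (hE.units_condIndep t)
    (fun j u hu => condExp_prodMk_eq_unitKernel hH (hE.measurable_arm t j)
      (hE.measurable_noise t j) ν (hE.noise_law t j) (hE.noise_indep_past t j)
      (p := π t) (hE.arm_law t j) (hE.condIndepGiven_noise t j) hu) hF hF1 hg hg1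
  have hprod : ∀ ω, ∏ j, g (A t j ω, ε t j ω)
      = Complex.exp ((∑ a, v a * scaledMeans b h n A ε ω t a : ℝ) * Complex.I) := by
    intro ω
    rw [sum_mul_scaledMeans_eq_sum_unit, ← Complex.exp_sum, ← Finset.sum_mul]
    push_cast
    rfl
  simp only [hprod, Kernel.comap_apply, integral_unitKernel ν _ hg hg1, Fintype.card_fin] at key
  exact key

end BatchedExperiment

theorem tendsto_batchSize_div {b : Fin T → ℝ} {t : Fin T} (hb : 0 ≤ b t) :
    Tendsto (fun n : ℕ => (batchSize b n t : ℝ) / n) atTop (𝓝 (b t)) :=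
  (tendsto_nat_floor_mul_div_atTop hb).comp tendsto_natCast_atTop_atTop

/-! ### The induction over epochs. -/

section Step

variable {b : Fin T → ℝ} {h s : Fin K → ℝ} {π : Policy K T} {C : ℝ≥0}
  {ν : ℕ → Measure (Fin K → ℝ)} {Ω : ℕ → Type*} [∀ n, MeasurableSpace (Ω n)]
  {P : (n : ℕ) → Measure (Ω n)} [∀ n, IsProbabilityMeasure (P n)]
  {A : (n : ℕ) → (t : Fin T) → Fin (batchSize b n t) → Ω n → Fin K}
  {ε : (n : ℕ) → (t : Fin T) → Fin (batchSize b n t) → Ω n → Fin K → ℝ}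
  {Ω' : Type*} [MeasurableSpace Ω'] {Q : Measure Ω'} [IsProbabilityMeasure Q]
  {G : Ω' → Fin T → Fin K → ℝ}

/-- If the means of the first `t` epochs converge in distribution, then so do their joint
characteristic functions with the mean of epoch `t`. -/
theorem tendsto_integral_exp_of_tendstoInDistribution_past (hb : ∀ t, 0 < b t)
    (hπ : ∀ t, Measurable (π t)) (hν : ∀ n, IsNoiseLaw s C (ν n))
    (hexp : ∀ n, IsBatchedExperiment b h π n (ν n) (A n) (ε n) (P n))
    (hG : IsGaussianSequentialExperiment b h s π G Q) (t : Fin T)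
    (hcont : (Q.map fun ω => past (G ω) t) {r | ¬ ContinuousAt (π t) r} = 0)
    (hpast : TendstoInDistribution (fun n ω => pastMeans b h n (A n) (ε n) t ω) atTop
      (fun ω => past (G ω) t) P Q)
    {F : (Fin t → Fin K → ℝ) → ℂ} (hF : Continuous F) (hF1 : ∀ r, ‖F r‖ ≤ 1) (v : Fin K → ℝ) :
    Tendsto (fun n => ∫ ω, F (pastMeans b h n (A n) (ε n) t ω) * Complex.exp
        ((∑ a, v a * scaledMeans b h n (A n) (ε n) ω t a : ℝ) * Complex.I) ∂P n) atTop
      (𝓝 (∫ ω, F (past (G ω) t) * Complex.exp ((∑ a, v a * G ω t a : ℝ) * Complex.I) ∂Q)) := by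
  have hprob : ∀ n, IsProbabilityMeasure (ν n) := fun n => (hν n).isProbabilityMeasure
  -- Keeping the allocation as a separate variable makes `Φ` continuous; the discontinuities of `π
  -- t` enter only through the graph map `r ↦ (r, π t r)`.
  let Φ : (Fin t → Fin K → ℝ) × stdSimplex ℝ (Fin K) → ℂ := fun z =>
    F z.1 * Complex.exp (b t * ∑ a, (z.2.1 a : ℂ) * armExponent h s (b t) v a)
  have hΦ : Continuous Φ := by
    refine (hF.comp continuous_fst).mul (Complex.continuous_exp.comp (continuous_const.mul
      (continuous_finsetSum _ fun a _ => Continuous.mul ?_ continuous_const)))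
    exact Complex.continuous_ofReal.comp ((continuous_apply a).comp
      (continuous_subtype_val.comp continuous_snd))
  have hΦ1 : ∀ z, ‖Φ z‖ ≤ 1 := fun z => by
    rw [norm_mul]
    exact mul_le_one₀ (hF1 _) (norm_nonneg _)
      (norm_exp_mul_sum_armExponent_le_one h s (hb t) z.2 v)
  have hgraph : Measurable fun r => (r, π t r) := measurable_id.prodMk (hπ t)
  have hnull : (Q.map fun ω => past (G ω) t) {r | ¬ ContinuousAt (fun r => (r, π t r)) r} = 0 := by
    refine measure_mono_null (fun r hr => ?_) hcont
    exact fun hr' => hr (continuousAt_id.prodMk hr')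
  have hH : Measurable fun ω => past (G ω) t := (measurable_past t).comp hG.measurable
  have hHn : ∀ n, Measurable (pastMeans b h n (A n) (ε n) t) := fun n =>
    (measurable_past t).comp (hexp n).measurable_scaledMeans
  have hlim := TendstoInDistribution.tendsto_integral
    (tendstoInDistribution_comp_of_ae_continuousAt hgraph hnull hpast) hΦ hΦ1
  have hQ : ∫ ω, Φ (past (G ω) t, π t (past (G ω) t)) ∂Q
      = ∫ ω, F (past (G ω) t) * Complex.exp ((∑ a, v a * G ω t a : ℝ) * Complex.I) ∂Q := by
    rw [hG.integral_mul_exp hb t hF.measurable hF1 v, integral_map hH.aemeasurable]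
    exact (hΦ.measurable.comp hgraph).aestronglyMeasurable
  rw [hQ] at hlim
  let ψ : ℕ → Fin K → ℂ := fun n a =>
    ∫ e, Complex.exp ((v a / b t / √(n : ℝ) * reward h n e a : ℝ) * Complex.I) ∂ν n
  have hψ : ∀ n a, ‖ψ n a‖ ≤ 1 := fun n a => by
    refine (norm_integral_le_of_norm_le_const (C := 1) (Eventually.of_forall fun e =>
      (Complex.norm_exp_ofReal_mul_I _).le)).trans ?_
    simp
  obtain ⟨δ, hδ, hδle⟩ := exists_tendsto_zero_norm_mixture_pow_sub_le hψ
    (armExponent_re_nonpos h s (b t) v)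
    (fun a => IsNoiseLaw.tendsto_natCast_mul_integral_exp_sub_one hν h a (v a / b t)) (hb t).le
    (tendsto_batchSize_div (hb t).le)
  rw [← sub_zero (∫ ω, F (past (G ω) t) * _ ∂Q)]
  -- The prelimit integral differs from that of `Φ` by at most `δ n`: the uniform bound applies
  -- pointwise at the random allocation.
  refine (hlim.sub (squeeze_zero_norm' ?_ hδ : Tendsto (fun n =>
    ∫ ω, Φ (pastMeans b h n (A n) (ε n) t ω, π t (pastMeans b h n (A n) (ε n) t ω)) ∂P n
    - ∫ ω, F (pastMeans b h n (A n) (ε n) t ω) * Complex.exp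
        ((∑ a, v a * scaledMeans b h n (A n) (ε n) ω t a : ℝ) * Complex.I) ∂P n)
    atTop (𝓝 0))).congr fun n => sub_sub_cancel _ _
  filter_upwards [hδle] with n hn
  have i1 : Integrable (fun ω =>
      Φ (pastMeans b h n (A n) (ε n) t ω, π t (pastMeans b h n (A n) (ε n) t ω))) (P n) :=
    Integrable.of_bound ((hΦ.measurable.comp hgraph).comp (hHn n)).aestronglyMeasurable 1
      (Eventually.of_forall fun ω => hΦ1 _)
  have hmix : ∀ p : stdSimplex ℝ (Fin K), ‖∑ a, (p.1 a : ℂ) * ψ n a‖ ≤ 1 := fun p => by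
    refine (norm_sum_le _ _).trans ?_
    rw [← p.2.2]
    refine Finset.sum_le_sum fun a _ => ?_
    rw [norm_mul, Complex.norm_of_nonneg (p.2.1 a)]
    exact mul_le_of_le_one_right (p.2.1 a) (hψ n a)
  have hmeas : Measurable fun r : Fin t → Fin K → ℝ =>
      F r * (∑ a, ((π t r).1 a : ℂ) * ψ n a) ^ batchSize b n t := by
    refine hF.measurable.mul (Measurable.pow_const (Finset.measurable_sum _ fun a _ =>
      Measurable.mul_const ?_ _) _)
    exact Complex.measurable_ofReal.comp ((measurable_pi_apply a).comp
      (measurable_subtype_coe.comp (hπ t)))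
  have i2 : Integrable (fun ω => F (pastMeans b h n (A n) (ε n) t ω)
      * (∑ a, ((π t (pastMeans b h n (A n) (ε n) t ω)).1 a : ℂ) * ψ n a) ^ batchSize b n t)
      (P n) := by
    refine Integrable.of_bound (hmeas.comp (hHn n)).aestronglyMeasurable 1
      (Eventually.of_forall fun ω => ?_)
    rw [norm_mul, norm_pow]
    exact mul_le_one₀ (hF1 _) (by positivity) (pow_le_one₀ (norm_nonneg _) (hmix _))
  rw [(hexp n).integral_mul_exp t (hπ t) hF.measurable hF1 v, ← integral_sub i1 i2]
  refine (norm_integral_le_of_norm_le_const (C := δ n) (Eventually.of_forall fun ω => ?_)).trans ?_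
  · rw [← mul_sub, norm_mul, norm_sub_rev]
    exact (mul_le_of_le_one_left (norm_nonneg _) (hF1 _)).trans (hn _)
  · simp

theorem tendstoInDistribution_castLE (hb : ∀ t, 0 < b t)
    (hπ : ∀ t, Measurable (π t)) (hν : ∀ n, IsNoiseLaw s C (ν n))
    (hexp : ∀ n, IsBatchedExperiment b h π n (ν n) (A n) (ε n) (P n))
    (hG : IsGaussianSequentialExperiment b h s π G Q)
    (hcont : ∀ t : Fin T, (Q.map fun ω => past (G ω) t) {r | ¬ ContinuousAt (π t) r} = 0)
    (m : ℕ) (hm : m ≤ T) :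
    TendstoInDistribution
      (fun n ω (i : Fin m) => scaledMeans b h n (A n) (ε n) ω (Fin.castLE hm i)) atTop
      (fun ω (i : Fin m) => G ω (Fin.castLE hm i)) P Q := by
  have hmeasS : ∀ n, Measurable fun ω (i : Fin m) =>
      scaledMeans b h n (A n) (ε n) ω (Fin.castLE hm i) := fun n =>
    measurable_pi_lambda _ fun i =>
      (measurable_pi_apply _).comp (hexp n).measurable_scaledMeans
  have hmeasG : Measurable fun ω (i : Fin m) => G ω (Fin.castLE hm i) :=
    measurable_pi_lambda _ fun i => (measurable_pi_apply _).comp hG.measurable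
  refine tendstoInDistribution_of_tendsto_integral_exp hmeasS hmeasG fun u => ?_
  induction m with
  | zero => simp
  | succ m ih =>
    let t : Fin T := ⟨m, hm⟩
    have hmeasS' : ∀ n, Measurable fun ω (i : Fin m) =>
        scaledMeans b h n (A n) (ε n) ω (Fin.castLE (Nat.le_of_succ_le hm) i) := fun n =>
      measurable_pi_lambda _ fun i =>
        (measurable_pi_apply _).comp (hexp n).measurable_scaledMeans
    have hmeasG' : Measurable fun ω (i : Fin m) =>
        G ω (Fin.castLE (Nat.le_of_succ_le hm) i) :=
      measurable_pi_lambda _ fun i => (measurable_pi_apply _).comp hG.measurable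
    -- The past of epoch `m` is by definition the first `m` coordinates, so the induction
    -- hypothesis, for all frequencies, gives its weak convergence by Lévy.
    have hpast : TendstoInDistribution (fun n ω => pastMeans b h n (A n) (ε n) t ω) atTop
        (fun ω => past (G ω) t) P Q :=
      tendstoInDistribution_of_tendsto_integral_exp hmeasS' hmeasG' fun u =>
        ih (Nat.le_of_succ_le hm) hmeasS' hmeasG' u
    let F : (Fin m → Fin K → ℝ) → ℂ := fun r =>
      Complex.exp ((∑ i, ∑ a, u (Fin.castSucc i) a * r i a : ℝ) * Complex.I)
    have hF : Continuous F := by fun_prop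
    have hstep := tendsto_integral_exp_of_tendstoInDistribution_past hb hπ hν hexp hG t (hcont t)
      hpast (F := F) hF (fun r => (Complex.norm_exp_ofReal_mul_I _).le) (u (Fin.last m))
    have hsplit : ∀ x : Fin T → Fin K → ℝ,
        F (past x t) * Complex.exp ((∑ a, u (Fin.last m) a * x t a : ℝ) * Complex.I)
          = Complex.exp ((∑ i, ∑ a, u i a * x (Fin.castLE hm i) a : ℝ) * Complex.I) := by
      intro x
      rw [Fin.sum_univ_castSucc, Complex.ofReal_add, add_mul, Complex.exp_add]
      rfl
    have hsplitS : ∀ n ω, F (pastMeans b h n (A n) (ε n) t ω) * Complex.exp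
        ((∑ a, u (Fin.last m) a * scaledMeans b h n (A n) (ε n) ω t a : ℝ) * Complex.I)
          = Complex.exp ((∑ i, ∑ a, u i a *
            scaledMeans b h n (A n) (ε n) ω (Fin.castLE hm i) a : ℝ) * Complex.I) :=
      fun n ω => hsplit _
    simp only [hsplit, hsplitS] at hstep
    exact hstep

end Step

end GaussianSequentialExperiment

open GaussianSequentialExperiment in
theorem theorem1 {K T : ℕ} (b : Fin T → ℝ) (hb : ∀ t, 0 < b t) (h s : Fin K → ℝ)
    (π : Policy K T) (hπ : ∀ t, Measurable (π t))
    -- for every `n`, a batched experiment whose noise law has moments bounded uniformly in `n`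
    (C : ℝ≥0) (ν : ℕ → Measure (Fin K → ℝ)) (hν : ∀ n, IsNoiseLaw s C (ν n))
    {Ω : ℕ → Type*} [∀ n, MeasurableSpace (Ω n)]
    (P : (n : ℕ) → Measure (Ω n)) [∀ n, IsProbabilityMeasure (P n)]
    (A : (n : ℕ) → (t : Fin T) → Fin (batchSize b n t) → Ω n → Fin K)
    (ε : (n : ℕ) → (t : Fin T) → Fin (batchSize b n t) → Ω n → Fin K → ℝ)
    (hexp : ∀ n, IsBatchedExperiment b h π n (ν n) (A n) (ε n) (P n))
    -- the Gaussian sequential experiment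
    {Ω' : Type*} [MeasurableSpace Ω'] (Q : Measure Ω') [IsProbabilityMeasure Q]
    (G : Ω' → Fin T → Fin K → ℝ) (hG : IsGaussianSequentialExperiment b h s π G Q)
    -- the discontinuity points of the policy are null for the Gaussian sequential experiment
    (hcont : ∀ t : Fin T, (Q.map fun ω => past (G ω) t) {r | ¬ ContinuousAt (π t) r} = 0) :
    TendstoInDistribution (fun n ω => scaledMeans b h n (A n) (ε n) ω) atTop G P Q := by
  exact tendstoInDistribution_castLE hb hπ hν hexp hG hcont T le_rfl
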